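/- Let $m,n\ge 0$ and $n_1,\dots,n_n\ge 0$ be integers, let $b\in\mathbb{R}^m$, let $A_i\in\mathbb{R}^{m\times n_i}$ and let $f_i:\mathbb{R}^{n_i}\to[-\infty,+\infty]$ $(i=1,\dots,n)$ be proper (that is, $f_i$ never takes the value $-\infty$ and its domain $\operatorname{dom} f_i=\{x: f_i(x)<+\infty\}$ is nonempty) and lower semicontinuous, with $\operatorname{dom} f_i$ bounded. Let $$p=\inf\Big\{\sum_{i=1}^n f_i(x^i)\;:\;x^i\in\mathbb{R}^{n_i},\ \sum_{i=1}^n A_ix^i\le b\Big\},\qquad d=\sup_{y\in\mathbb{R}^m,\ y\ge 0}\Big\{-\sum_{i=1}^n f_i^*(-A_i^Ty)-b^Ty\Big\}$$ be the optimal values of the primal problem and of its dual, where vector inequalities are componentwise and $f_i^*(u)=\sup_x\{u^Tx-f_i(x)\}$ is the conjugate of $f_i$. For an integer $k\ge 1$ let $$\rho^k(f_i)=\sup\Big\{f_i\Big(\sum_{j=1}^k\alpha_jx^j\Big)-\sum_{j=1}^k\alpha_jf_i(x^j)\;:\;x^j\in\operatorname{dom} f_i,\ \alpha_j\ge 0,\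 \sum_{j=1}^k\alpha_j=1\Big\}\in[0,+\infty]$$ be the $k$th nonconvexity of $f_i$. Assume that the primal problem is feasible, i.e. $p<+\infty$. Then $p$ and $d$ are finite, and there exist integers $1\le k_i\le m+1$ $(i=1,\dots,n)$ with $\sum_{i=1}^n k_i\le m+n$ such that the duality gap satisfies $$p-d\le\sum_{i=1}^n\rho^{k_i}(f_i).$$ -/

import Mathlib

open scoped Matrix

namespace SeparableDuality

/-- The effective domain `{x | f x < +∞}` of an extended-real-valued function. -/
def dom {E : Type*} (f : E → EReal) : Set E := {x | f x < ⊤}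

/-- A proper function: it never takes the value `-∞` and its domain is nonempty. -/
def IsProper {E : Type*} (f : E → EReal) : Prop :=
  (∀ x, f x ≠ ⊥) ∧ (dom f).Nonempty

/-- The `k`-th nonconvexity of `f`: the supremum in `[-∞, +∞]` of
`f (∑ j, α j • x j) - ∑ j, α j * f (x j)` over all convex combinations of `k`
(not necessarily distinct) points of the domain of `f`. -/
noncomputable def nonconvexity {E : Type*} [AddCommGroup E] [Module ℝ E]
    (k : ℕ) (f : E → EReal) : EReal :=
  sSup {r : EReal | ∃ (α : Fin k → ℝ) (x : Fin k → E),
    (∀ j, 0 ≤ α j) ∧ ∑ j, α j = 1 ∧ (∀ j, x j ∈ dom f) ∧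
      r = f (∑ j, α j • x j) - ∑ j, (α j : EReal) * f (x j)}

/-- The conjugate function `f* (y) = sup_x (yᵀ x - f x)`. -/
noncomputable def conjugate {N : ℕ} (f : (Fin N → ℝ) → EReal) (y : Fin N → ℝ) : EReal :=
  ⨆ x : Fin N → ℝ, (((y ⬝ᵥ x : ℝ) : EReal) - f x)

/-- The optimal value of: minimize `∑ i, f i (x i)` subject to `∑ i, A i *ᵥ x i ≤ b`
(componentwise). It is `+∞` exactly when no `x` that satisfies the constraint has a
finite objective value (for functions that never take the value `-∞`). -/
noncomputable def primalValue {m n : ℕ} {N : Fin n → ℕ}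
    (f : (i : Fin n) → (Fin (N i) → ℝ) → EReal)
    (A : (i : Fin n) → Matrix (Fin m) (Fin (N i)) ℝ) (b : Fin m → ℝ) : EReal :=
  ⨅ x ∈ {x : (i : Fin n) → Fin (N i) → ℝ | ∑ i, A i *ᵥ x i ≤ b}, ∑ i, f i (x i)

/-- The optimal value of the dual problem: maximize `-∑ i, (f i)* (-(A i)ᵀ y) - bᵀ y`
subject to `0 ≤ y` (componentwise). -/
noncomputable def dualValue {m n : ℕ} {N : Fin n → ℕ}
    (f : (i : Fin n) → (Fin (N i) → ℝ) → EReal)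
    (A : (i : Fin n) → Matrix (Fin m) (Fin (N i)) ℝ) (b : Fin m → ℝ) : EReal :=
  ⨆ y ∈ {y : Fin m → ℝ | 0 ≤ y},
    (-(∑ i, conjugate (f i) (-((A i)ᵀ *ᵥ y))) - ((b ⬝ᵥ y : ℝ) : EReal))

end SeparableDuality

/-! The pairs (constraint value, cost) attainable for the summand `i` form the image of the epigraph
of `f i` under `A i`; let `S` be the sum of these images. The upper closure of `S` is closed,
because the domains are bounded, so `(b, t)` belongs to it exactly when `p ≤ t`, while a
separating hyperplane shows that `(b, d)` belongs to the closure of the upper closure of the convex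
hull of `S`. A cost-decreasing Carathéodory reduction, carried out in `ℝᵐ × ℝⁿ` with one extra
coordinate per summand, puts every point of that hull above a sum of convex combinations of `k i`
points of the `i`-th image, with `∑ k i ≤ m + n`. There are finitely many such `k`, so one of them
serves `(b, d)`, and replacing each convex combination by its barycentre costs `ρ^{k i}(f i)`. -/

namespace SeparableDuality

section Caratheodory

variable {𝕜 ι κ V : Type*} [Field 𝕜] [LinearOrder 𝕜] [IsStrictOrderedRing 𝕜]
  [AddCommGroup V] [Module 𝕜 V]

lemma exists_dependency_sum_mul_nonpos {v : κ → V} {s : Finset κ}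
    (hs : ¬ LinearIndepOn 𝕜 v (s : Set κ)) {φ : V →ₗ[𝕜] 𝕜} (hφ : ∀ j ∈ s, 0 < φ (v j))
    (c : κ → 𝕜) :
    ∃ l : κ → 𝕜, ∑ j ∈ s, l j • v j = 0 ∧ ∑ j ∈ s, l j * c j ≤ 0 ∧ ∃ j ∈ s, l j < 0 := by
  obtain ⟨g, hg, j₀, hj₀, hgj₀⟩ : ∃ g : κ → 𝕜, ∑ j ∈ s, g j • v j = 0 ∧ ∃ j ∈ s, g j ≠ 0 := by
    simpa only [linearIndepOn_finset_iff, not_forall, exists_prop] using hs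
  -- `φ` forces every nonzero linear relation among the `v j` to have entries of both signs.
  have exists_neg : ∀ l : κ → 𝕜, ∑ j ∈ s, l j • v j = 0 → l j₀ ≠ 0 → ∃ j ∈ s, l j < 0 := by
    intro l hl hlj₀
    have hsum : ∑ j ∈ s, -(l j * φ (v j)) = 0 := by
      simpa [map_sum] using congrArg φ hl
    obtain ⟨j, hj, hpos⟩ := Finset.exists_pos_of_sum_zero_of_exists_nonzero _ hsum
      ⟨j₀, hj₀, neg_ne_zero.2 (mul_ne_zero hlj₀ (hφ j₀ hj₀).ne')⟩
    exact ⟨j, hj, neg_of_mul_neg_left (neg_pos.1 hpos) (hφ j hj).le⟩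
  rcases le_total (∑ j ∈ s, g j * c j) 0 with h | h
  · exact ⟨g, hg, h, exists_neg g hg hgj₀⟩
  · have hg' : ∑ j ∈ s, (-g) j • v j = 0 := by simp [hg]
    exact ⟨-g, hg', by simpa using h, exists_neg _ hg' (neg_ne_zero.2 hgj₀)⟩

lemma exists_add_mul_nonneg_and_eq_zero {s : Finset κ} {w l : κ → 𝕜} (hw : ∀ j ∈ s, 0 ≤ w j)
    (hl : ∃ j ∈ s, l j < 0) :
    ∃ r : 𝕜, 0 ≤ r ∧ (∀ j ∈ s, 0 ≤ w j + r * l j) ∧ ∃ j ∈ s, w j + r * l j = 0 := by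
  obtain ⟨j₀, hj₀, hmin⟩ := Finset.exists_min_image {j ∈ s | l j < 0} (fun j => w j / -l j)
    (by simpa [Finset.Nonempty] using hl)
  simp only [Finset.mem_filter, and_imp] at hj₀ hmin
  obtain ⟨hj₀s, hlj₀⟩ := hj₀
  have hr : 0 ≤ w j₀ / -l j₀ := div_nonneg (hw j₀ hj₀s) (neg_nonneg.2 hlj₀.le)
  refine ⟨w j₀ / -l j₀, hr, fun j hj => ?_, j₀, hj₀s, ?_⟩
  · rcases lt_or_ge (l j) 0 with hlj | hlj
    · have := (le_div_iff₀ (neg_pos.2 hlj)).1 (hmin j hj hlj)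
      linarith
    · exact add_nonneg (hw j hj) (mul_nonneg hr hlj)
  · field [hlj₀.ne]

lemma exists_ssubset_sum_smul_eq [FiniteDimensional 𝕜 V] {v : κ → V} {s : Finset κ}
    (hs : Module.finrank 𝕜 V < s.card) {φ : V →ₗ[𝕜] 𝕜} (hφ : ∀ j ∈ s, 0 < φ (v j))
    (c : κ → 𝕜) {w : κ → 𝕜} (hw : ∀ j ∈ s, 0 ≤ w j) :
    ∃ t ⊂ s, ∃ w' : κ → 𝕜, (∀ j ∈ t, 0 ≤ w' j) ∧
      ∑ j ∈ t, w' j • v j = ∑ j ∈ s, w j • v j ∧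
      ∑ j ∈ t, w' j * c j ≤ ∑ j ∈ s, w j * c j := by
  classical
  have hdep : ¬ LinearIndepOn 𝕜 v (s : Set κ) := fun h => by
    have := h.linearIndependent.fintype_card_le_finrank
    simp only [SetLike.coe_sort_coe, Fintype.card_coe] at this
    omega
  obtain ⟨l, hlv, hlc, hneg⟩ := exists_dependency_sum_mul_nonpos hdep hφ c
  obtain ⟨r, hr, hnonneg, j₀, hj₀, hzero⟩ := exists_add_mul_nonneg_and_eq_zero hw hneg
  refine ⟨s.erase j₀, Finset.erase_ssubset hj₀, fun j => w j + r * l j,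
    fun j hj => hnonneg j (Finset.mem_of_mem_erase hj), ?_, ?_⟩
  · rw [Finset.sum_erase _ (by simp only [hzero, zero_smul])]
    simp only [add_smul, mul_smul, Finset.sum_add_distrib, ← Finset.smul_sum, hlv, smul_zero,
      add_zero]
  · rw [Finset.sum_erase _ (by simp only [hzero, zero_mul])]
    simp only [add_mul, mul_assoc, Finset.sum_add_distrib, ← Finset.mul_sum]
    exact add_le_of_nonpos_right (mul_nonpos_of_nonneg_of_nonpos hr hlc)

theorem exists_subset_card_le_finrank_sum_smul_eq [FiniteDimensional 𝕜 V] {v : κ → V}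
    {s : Finset κ} {φ : V →ₗ[𝕜] 𝕜} (hφ : ∀ j ∈ s, 0 < φ (v j)) (c : κ → 𝕜) {w : κ → 𝕜}
    (hw : ∀ j ∈ s, 0 ≤ w j) :
    ∃ t ⊆ s, t.card ≤ Module.finrank 𝕜 V ∧ ∃ w' : κ → 𝕜, (∀ j ∈ t, 0 ≤ w' j) ∧
      ∑ j ∈ t, w' j • v j = ∑ j ∈ s, w j • v j ∧
      ∑ j ∈ t, w' j * c j ≤ ∑ j ∈ s, w j * c j := by
  induction s using Finset.strongInduction generalizing w with
  | H s ih =>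
    rcases le_or_gt s.card (Module.finrank 𝕜 V) with hs | hs
    · exact ⟨s, subset_rfl, hs, w, hw, rfl, le_rfl⟩
    · obtain ⟨t, hts, w₁, hw₁, hv₁, hc₁⟩ := exists_ssubset_sum_smul_eq hs hφ c hw
      obtain ⟨u, hut, hu, w₂, hw₂, hv₂, hc₂⟩ := ih t hts (fun j hj => hφ j (hts.subset hj)) hw₁
      exact ⟨u, hut.trans hts.subset, hu, w₂, hw₂, hv₂.trans hv₁, hc₂.trans hc₁⟩

lemma exists_subset_card_le_fiberwise [FiniteDimensional 𝕜 V] [Fintype ι] [DecidableEq ι]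
    (σ : κ → ι) (q : κ → V × 𝕜) {s : Finset κ} {w : κ → 𝕜} (hw : ∀ j ∈ s, 0 ≤ w j)
    (hw1 : ∀ i, ∑ j ∈ s with σ j = i, w j = 1) :
    ∃ t ⊆ s, t.card ≤ Module.finrank 𝕜 V + Fintype.card ι ∧ ∃ w' : κ → 𝕜,
      (∀ j ∈ t, 0 ≤ w' j) ∧ (∀ i, ∑ j ∈ t with σ j = i, w' j = 1) ∧
      (∑ j ∈ t, w' j • q j).1 = (∑ j ∈ s, w j • q j).1 ∧
      (∑ j ∈ t, w' j • q j).2 ≤ (∑ j ∈ s, w j • q j).2 := by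
  -- The second component of `v` records the total weight of each fiber of `σ`.
  let v : κ → V × (ι → 𝕜) := fun j => ((q j).1, Pi.single (σ j) 1)
  let φ : V × (ι → 𝕜) →ₗ[𝕜] 𝕜 := (∑ i, LinearMap.proj i) ∘ₗ LinearMap.snd 𝕜 V (ι → 𝕜)
  have hφ : ∀ j ∈ s, 0 < φ (v j) := fun j _ => by simp [φ, v]
  have hfiber : ∀ (t : Finset κ) (w : κ → 𝕜) (i : ι),
      (∑ j ∈ t, w j • v j).2 i = ∑ j ∈ t with σ j = i, w j := fun t w i => by
    simp [v, Prod.snd_sum, Finset.sum_apply, Pi.single_apply, Finset.sum_filter, eq_comm]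
  obtain ⟨t, hts, hcard, w', hw', hv, hc⟩ :=
    exists_subset_card_le_finrank_sum_smul_eq hφ (fun j => (q j).2) hw
  refine ⟨t, hts, by simpa using hcard, w', hw', fun i => ?_, ?_, ?_⟩
  · rw [← hfiber, hv, hfiber, hw1]
  · simpa [v, Prod.fst_sum] using congrArg Prod.fst hv
  · simpa [Prod.snd_sum] using hc

end Caratheodory

section ShapleyFolkman

open scoped Pointwise

/-- The set of convex combinations of `k` (not necessarily distinct) points of `S`, which is
the part of the convex hull of `S` that the `k`-th nonconvexity of a function sees. -/
def convexCombinations (𝕜 : Type*) {E : Type*} [Semiring 𝕜] [PartialOrder 𝕜] [AddCommMonoid E]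
    [Module 𝕜 E] (k : ℕ) (S : Set E) : Set E :=
  {z | ∃ (α : Fin k → 𝕜) (x : Fin k → E),
    (∀ j, 0 ≤ α j) ∧ ∑ j, α j = 1 ∧ (∀ j, x j ∈ S) ∧ ∑ j, α j • x j = z}

lemma sum_equivFin_symm {κ M : Type*} [AddCommMonoid M] (s : Finset κ) (g : κ → M) :
    ∑ a, g (s.equivFin.symm a) = ∑ j ∈ s, g j := by
  rw [← Finset.sum_coe_sort s g]
  exact Equiv.sum_comp s.equivFin.symm fun j : s => g j

lemma sum_mem_convexCombinations {𝕜 E κ : Type*} [Semiring 𝕜] [PartialOrder 𝕜] [AddCommMonoid E]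
    [Module 𝕜 E] {S : Set E} {s : Finset κ} {w : κ → 𝕜} {x : κ → E} (hw : ∀ j ∈ s, 0 ≤ w j)
    (hw1 : ∑ j ∈ s, w j = 1) (hx : ∀ j ∈ s, x j ∈ S) :
    ∑ j ∈ s, w j • x j ∈ convexCombinations 𝕜 s.card S :=
  ⟨fun a => w (s.equivFin.symm a), fun a => x (s.equivFin.symm a),
    fun a => hw _ (s.equivFin.symm a).2, (sum_equivFin_symm s w).trans hw1,
    fun a => hx _ (s.equivFin.symm a).2, sum_equivFin_symm s fun j => w j • x j⟩

variable {𝕜 ι V : Type*} [Field 𝕜] [LinearOrder 𝕜] [IsStrictOrderedRing 𝕜] [AddCommGroup V]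
  [Module 𝕜 V] [FiniteDimensional 𝕜 V] [Fintype ι]

theorem exists_sum_convexCombinations_le_of_mem_convexHull_sum {S : ι → Set (V × 𝕜)} {z : V × 𝕜}
    (hz : z ∈ convexHull 𝕜 (∑ i, S i)) :
    ∃ k : ι → ℕ, (∀ i, 1 ≤ k i) ∧ ∑ i, k i ≤ Module.finrank 𝕜 V + Fintype.card ι ∧
      ∃ z' ∈ ∑ i, convexCombinations 𝕜 (k i) (S i), z'.1 = z.1 ∧ z'.2 ≤ z.2 := by
  classical
  rw [convexHull_sum, Set.mem_fintype_sum] at hz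
  obtain ⟨p, hp, rfl⟩ := hz
  choose J hJ w q hw hw1 hq hqp using fun i => mem_convexHull_iff_exists_fintype.1 (hp i)
  have hw1' : ∀ i, ∑ j : Σ i, J i with j.1 = i, w j.1 j.2 = 1 := fun i => by
    rw [Finset.sum_filter, Fintype.sum_sigma, Fintype.sum_eq_single i (by simp +contextual)]
    simpa using hw1 i
  obtain ⟨t, -, hcard, w', hw', hw'1, hfst, hsnd⟩ :=
    exists_subset_card_le_fiberwise Sigma.fst (fun j : Σ i, J i => q j.1 j.2)
      (s := Finset.univ) (w := fun j => w j.1 j.2) (fun j _ => hw j.1 j.2) hw1'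
  simp only [Fintype.sum_sigma, hqp] at hfst hsnd
  refine ⟨fun i => Finset.card {j ∈ t | j.1 = i}, fun i => ?_, ?_, ∑ j ∈ t, w' j • q j.1 j.2,
    ?_, hfst, hsnd⟩
  · rw [Nat.one_le_iff_ne_zero, Finset.card_ne_zero]
    exact Finset.nonempty_of_sum_ne_zero ((hw'1 i).trans_ne one_ne_zero)
  · have hmaps : (t : Set (Σ i, J i)).MapsTo Sigma.fst (Finset.univ : Finset ι) := fun _ _ =>
      Finset.mem_coe.2 (Finset.mem_univ _)
    exact (Finset.card_eq_sum_card_fiberwise hmaps).ge.trans hcard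
  · rw [← Finset.sum_fiberwise t Sigma.fst]
    refine Set.finsetSum_mem_finsetSum _ _ _ fun i _ => sum_mem_convexCombinations
      (fun j hj => hw' j (Finset.mem_filter.1 hj).1) (hw'1 i) fun j hj => ?_
    exact (Finset.mem_filter.1 hj).2 ▸ hq j.1 j.2

lemma finite_setOf_sum_le (N : ℕ) : {k : ι → ℕ | ∑ i, k i ≤ N}.Finite :=
  (Set.Finite.pi' fun _ => Set.finite_Iic N).subset fun _ hk i =>
    (Finset.single_le_sum (fun _ _ => Nat.zero_le _) (Finset.mem_univ i)).trans hk

lemma le_add_one_of_sum_le_add_card {k : ι → ℕ} {N : ℕ} (hk : ∀ i, 1 ≤ k i)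
    (hsum : ∑ i, k i ≤ N + Fintype.card ι) (i : ι) : k i ≤ N + 1 := by
  have hsub : ∑ j, (k j - 1) + Fintype.card ι = ∑ j, k j := by
    simp only [Fintype.card_eq_sum_ones, ← Finset.sum_add_distrib, Nat.sub_add_cancel (hk _)]
  have hle : k i - 1 ≤ ∑ j, (k j - 1) :=
    Finset.single_le_sum (f := fun j => k j - 1) (fun _ _ => Nat.zero_le _) (Finset.mem_univ i)
  omega

lemma exists_mem_closure_upperClosure_sum_convexCombinations {V : Type*} [AddCommGroup V]
    [Module ℝ V] [FiniteDimensional ℝ V] [PartialOrder V] [TopologicalSpace V]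
    {S : ι → Set (V × ℝ)} {z : V × ℝ}
    (hz : z ∈ closure (upperClosure (convexHull ℝ (∑ i, S i)) : Set (V × ℝ))) :
    ∃ k : ι → ℕ, (∀ i, 1 ≤ k i) ∧ ∑ i, k i ≤ Module.finrank ℝ V + Fintype.card ι ∧
      z ∈ closure (upperClosure (∑ i, convexCombinations ℝ (k i) (S i)) : Set (V × ℝ)) := by
  let K : Set (ι → ℕ) :=
    {k | (∀ i, 1 ≤ k i) ∧ ∑ i, k i ≤ Module.finrank ℝ V + Fintype.card ι}
  have hK : K.Finite := (finite_setOf_sum_le _).subset fun _ hk => hk.2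
  have hsub : (upperClosure (convexHull ℝ (∑ i, S i)) : Set (V × ℝ)) ⊆
      ⋃ k ∈ K, (upperClosure (∑ i, convexCombinations ℝ (k i) (S i)) : Set (V × ℝ)) := by
    rintro v ⟨u, hu, huv⟩
    obtain ⟨k, hk1, hk, u', hu', hfst, hsnd⟩ :=
      exists_sum_convexCombinations_le_of_mem_convexHull_sum hu
    exact Set.mem_iUnion₂.2 ⟨k, ⟨hk1, hk⟩, u', hu', (Prod.mk_le_mk.2 ⟨hfst.le, hsnd⟩).trans huv⟩
  have hz' := closure_mono hsub hz
  rw [hK.closure_biUnion, Set.mem_iUnion₂] at hz'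
  obtain ⟨k, ⟨hk1, hk⟩, hzk⟩ := hz'
  exact ⟨k, hk1, hk, hzk⟩

end ShapleyFolkman

section EReal

lemma coe_sum {ι : Type*} (s : Finset ι) (g : ι → ℝ) :
    ((∑ i ∈ s, g i : ℝ) : EReal) = ∑ i ∈ s, (g i : EReal) :=
  map_sum (⟨⟨Real.toEReal, EReal.coe_zero⟩, EReal.coe_add⟩ : ℝ →+ EReal) g s

lemma sum_ne_bot {ι : Type*} {s : Finset ι} {g : ι → EReal} (h : ∀ i ∈ s, g i ≠ ⊥) :
    ∑ i ∈ s, g i ≠ ⊥ := fun hs =>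
  let ⟨i, hi, hgi⟩ := WithBot.sum_eq_bot_iff.1 hs
  h i hi hgi

lemma exists_forall_eq_coe_of_sum_ne_top {ι : Type*} [Fintype ι] {g : ι → EReal}
    (hbot : ∀ i, g i ≠ ⊥) (htop : ∑ i, g i ≠ ⊤) : ∃ r : ι → ℝ, ∀ i, g i = r i := by
  classical
  refine ⟨fun i => (g i).toReal, fun i => (EReal.coe_toReal (fun hi => htop ?_) (hbot i)).symm⟩
  rw [← Finset.add_sum_erase _ _ (Finset.mem_univ i), hi,
    EReal.top_add_of_ne_bot (sum_ne_bot fun j _ => hbot j)]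

lemma lowerSemicontinuous_sum_of_ne_bot {X ι : Type*} [TopologicalSpace X] {g : ι → X → EReal}
    (hbot : ∀ i x, g i x ≠ ⊥) (hg : ∀ i, LowerSemicontinuous (g i)) (s : Finset ι) :
    LowerSemicontinuous fun x => ∑ i ∈ s, g i x := by
  classical
  induction s using Finset.induction_on with
  | empty => simpa only [Finset.sum_empty] using lowerSemicontinuous_const
  | insert a s ha ih =>
    simp only [Finset.sum_insert ha]
    exact (hg a).add' ih fun x => EReal.continuousAt_add
      (Or.inr (sum_ne_bot fun i _ => hbot i x)) (Or.inl (hbot a x))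

end EReal

section Nonconvexity

variable {E : Type*} [AddCommGroup E] [Module ℝ E] {f : E → EReal}

lemma le_nonconvexity_add {k : ℕ} {α t : Fin k → ℝ} {x : Fin k → E} (hbot : ∀ x, f x ≠ ⊥)
    (hα : ∀ j, 0 ≤ α j) (hα1 : ∑ j, α j = 1) (hx : ∀ j, f (x j) ≤ t j) :
    f (∑ j, α j • x j) ≤ nonconvexity k f + ((∑ j, α j * t j : ℝ) : EReal) := by
  have hdom : ∀ j, x j ∈ dom f := fun j => (hx j).trans_lt (EReal.coe_lt_top _)
  lift f ∘ x to Fin k → ℝ using fun j => ⟨(hdom j).ne, hbot _⟩ with r hr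
  replace hr : ∀ j, f (x j) = r j := fun j => (congrFun hr j).symm
  have hle : f (∑ j, α j • x j) - ((∑ j, α j * r j : ℝ) : EReal) ≤ nonconvexity k f :=
    le_sSup ⟨α, x, hα, hα1, hdom, by simp only [coe_sum, EReal.coe_mul, hr]⟩
  refine ((EReal.sub_le_iff_le_add (.inl (EReal.coe_ne_bot _)) (.inl (EReal.coe_ne_top _))).1
    hle).trans ?_
  gcongr with j
  · exact hα j
  · simpa only [hr, EReal.coe_le_coe_iff] using hx j

lemma nonconvexity_nonneg (hf : IsProper f) {k : ℕ} (hk : 1 ≤ k) : 0 ≤ nonconvexity k f := by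
  obtain ⟨x, hx⟩ := hf.2
  lift f x to ℝ using ⟨hx.ne, hf.1 x⟩ with r hr
  refine le_sSup ⟨Pi.single ⟨0, hk⟩ 1, fun _ => x, ?_, ?_, fun _ => hx, ?_⟩
  · exact fun j => (Pi.single_nonneg (i := (⟨0, hk⟩ : Fin k)).2 zero_le_one : (0 : Fin k → ℝ) ≤ _) j
  · simp
  · rw [← Finset.sum_smul, Finset.sum_pi_single']
    simp only [← hr, ← EReal.coe_mul, ← coe_sum, ← Finset.sum_mul]
    simp [← hr]

end Nonconvexity

section EpigraphImage

open scoped Pointwise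

/-- The image of the epigraph of `f` under `(x, t) ↦ (L x, t)`: the pairs of a constraint value
and a cost that are attainable for a single summand of the primal problem. -/
def epigraphImage {E V : Type*} (L : E → V) (f : E → EReal) : Set (V × ℝ) :=
  {z | ∃ x, L x = z.1 ∧ f x ≤ z.2}

lemma add_mem_epigraphImage_of_mem_convexCombinations {E V : Type*} [AddCommGroup E] [Module ℝ E]
    [AddCommGroup V] [Module ℝ V] {L : E →ₗ[ℝ] V} {f : E → EReal} (hbot : ∀ x, f x ≠ ⊥) {k : ℕ}
    {ρ : ℝ} (hρ : nonconvexity k f ≤ ρ) {z : V × ℝ}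
    (hz : z ∈ convexCombinations ℝ k (epigraphImage L f)) : z + (0, ρ) ∈ epigraphImage L f := by
  obtain ⟨α, p, hα, hα1, hp, rfl⟩ := hz
  choose x hLx hfx using hp
  refine ⟨∑ j, α j • x j, by simp [Prod.fst_sum, hLx],
    (le_nonconvexity_add hbot hα hα1 hfx).trans ?_⟩
  simp only [Prod.snd_add, Prod.snd_sum, Prod.smul_snd, smul_eq_mul, EReal.coe_add, add_comm]
  gcongr

variable {ι : Type*} [Fintype ι] {E : ι → Type*} {V : Type*} [AddCommMonoid V] [PartialOrder V]

lemma mem_upperClosure_sum_epigraphImage {L : (i : ι) → E i → V} {f : (i : ι) → E i → EReal}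
    (hbot : ∀ i x, f i x ≠ ⊥) {z : V × ℝ} :
    z ∈ upperClosure (∑ i, epigraphImage (L i) (f i)) ↔
      ∃ x : (i : ι) → E i, ∑ i, L i (x i) ≤ z.1 ∧ ∑ i, f i (x i) ≤ z.2 := by
  constructor
  · rintro ⟨v, hv, hvz⟩
    obtain ⟨p, hp, rfl⟩ := (Set.mem_fintype_sum _ _).1 hv
    choose x hLx hfx using hp
    refine ⟨x, by simpa only [hLx, Prod.fst_sum] using hvz.1, ?_⟩
    calc ∑ i, f i (x i) ≤ ∑ i, ((p i).2 : EReal) := Finset.sum_le_sum fun i _ => hfx i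
      _ = (((∑ i, p i).2 : ℝ) : EReal) := by rw [Prod.snd_sum, coe_sum]
      _ ≤ z.2 := EReal.coe_le_coe hvz.2
  · rintro ⟨x, hL, hf⟩
    obtain ⟨r, hr⟩ := exists_forall_eq_coe_of_sum_ne_top (fun i => hbot i (x i))
      (hf.trans_lt (EReal.coe_lt_top _)).ne
    refine ⟨∑ i, (L i (x i), r i), Set.finsetSum_mem_finsetSum _ _ _ fun i _ =>
      ⟨x i, rfl, (hr i).le⟩, ?_⟩
    simp only [hr, ← coe_sum, EReal.coe_le_coe_iff] at hf
    exact ⟨by simpa only [Prod.fst_sum] using hL, by simpa only [Prod.snd_sum] using hf⟩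

lemma isClosed_upperClosure_sum_epigraphImage [∀ i, TopologicalSpace (E i)] [TopologicalSpace V]
    [OrderClosedTopology V] [ContinuousAdd V]
    {L : (i : ι) → E i → V} {f : (i : ι) → E i → EReal} (hbot : ∀ i x, f i x ≠ ⊥)
    (hL : ∀ i, Continuous (L i)) (hlsc : ∀ i, LowerSemicontinuous (f i))
    (hK : ∀ i, IsCompact (closure (dom (f i)))) :
    IsClosed (upperClosure (∑ i, epigraphImage (L i) (f i)) : Set (V × ℝ)) := by
  let K : Set ((i : ι) → E i) := Set.univ.pi fun i => closure (dom (f i))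
  have : CompactSpace K := isCompact_iff_compactSpace.1 (isCompact_univ_pi hK)
  let G : Set (K × (V × ℝ)) :=
    {p | ∑ i, L i (p.1.1 i) ≤ p.2.1 ∧ ∑ i, f i (p.1.1 i) ≤ (p.2.2 : EReal)}
  have hG : IsClosed G := by
    have hsum : LowerSemicontinuous fun x : (i : ι) → E i => ∑ i, f i (x i) :=
      lowerSemicontinuous_sum_of_ne_bot (g := fun i (x : (i : ι) → E i) => f i (x i))
        (fun i x => hbot i (x i)) (fun i => (hlsc i).comp (continuous_apply i)) _
    have hLsum : Continuous fun p : K × (V × ℝ) => ∑ i, L i (p.1.1 i) :=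
      continuous_finsetSum _ fun i _ => (hL i).comp
        ((continuous_apply i).comp (continuous_subtype_val.comp continuous_fst))
    refine (isClosed_le hLsum (by fun_prop)).inter
      (hsum.isClosed_epigraph.preimage (f := fun p : K × (V × ℝ) => (p.1.1, (p.2.2 : EReal))) ?_)
    exact (by fun_prop : Continuous fun p : K × (V × ℝ) => p.1.1).prodMk
      (continuous_coe_real_ereal.comp (by fun_prop))
  convert isClosedMap_snd_of_compactSpace G hG
  ext z
  rw [SetLike.mem_coe, mem_upperClosure_sum_epigraphImage hbot]
  constructor
  · rintro ⟨x, hLx, hfx⟩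
    obtain ⟨r, hr⟩ := exists_forall_eq_coe_of_sum_ne_top (fun i => hbot i (x i))
      (hfx.trans_lt (EReal.coe_lt_top _)).ne
    exact ⟨(⟨x, fun i _ => subset_closure ((hr i).trans_lt (EReal.coe_lt_top _))⟩, z),
      ⟨hLx, hfx⟩, rfl⟩
  · rintro ⟨⟨x, z⟩, ⟨hLx, hfx⟩, rfl⟩
    exact ⟨x, hLx, hfx⟩

end EpigraphImage

section LagrangeMultiplier

lemma convex_upperClosure {𝕜 E : Type*} [Semiring 𝕜] [PartialOrder 𝕜] [AddCommMonoid E]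
    [PartialOrder E] [IsOrderedAddMonoid E] [Module 𝕜 E] [PosSMulMono 𝕜 E] {s : Set E}
    (hs : Convex 𝕜 s) : Convex 𝕜 (upperClosure s : Set E) := by
  rintro x ⟨u, hu, hux⟩ y ⟨v, hv, hvy⟩ a b ha hb hab
  exact ⟨a • u + b • v, hs hu hv ha hb hab, by gcongr⟩

lemma map_nonneg_of_forall_mem_upperSet_lt {𝕜 E : Type*} [Field 𝕜] [LinearOrder 𝕜]
    [IsStrictOrderedRing 𝕜] [AddCommGroup E] [PartialOrder E] [IsOrderedAddMonoid E] [Module 𝕜 E]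
    [PosSMulMono 𝕜 E] {U : Set E} (hU : IsUpperSet U) (hne : U.Nonempty) {F : E →ₗ[𝕜] 𝕜} {c : 𝕜}
    (hF : ∀ z ∈ U, c < F z) {v : E} (hv : 0 ≤ v) : 0 ≤ F v := by
  obtain ⟨z, hz⟩ := hne
  by_contra! hneg
  have hr : 0 ≤ (F z - c) / -F v :=
    div_nonneg (sub_nonneg.2 (hF z hz).le) (neg_nonneg.2 hneg.le)
  have hlt := hF _ (hU (le_add_of_nonneg_right (smul_nonneg hr hv)) hz)
  rw [map_add, map_smul, smul_eq_mul, div_neg, neg_mul, div_mul_cancel₀ _ hneg.ne] at hlt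
  linarith

variable {ι : Type*} [Fintype ι]

lemma exists_map_eq_mul_add_dotProduct [DecidableEq ι] (F : (ι → ℝ) × ℝ →ₗ[ℝ] ℝ)
    (hF : F (0, 1) ≠ 0) (z : (ι → ℝ) × ℝ) :
    F z = F (0, 1) * (z.2 + z.1 ⬝ᵥ fun j => F (Pi.single j 1, 0) / F (0, 1)) := by
  have hz : z = ∑ j, z.1 j • ((Pi.single j 1, 0) : (ι → ℝ) × ℝ) + z.2 • (0, 1) := by
    ext <;> simp [Prod.fst_sum, Prod.snd_sum, Finset.sum_apply, Pi.single_apply]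
  conv_lhs => rw [hz]
  simp only [map_add, map_sum, map_smul, smul_eq_mul, dotProduct, mul_add, Finset.mul_sum]
  rw [add_comm, mul_comm]
  congr! 2 with j
  field

theorem exists_lagrange_multiplier {U : Set ((ι → ℝ) × ℝ)} (hconv : Convex ℝ U)
    (hU : IsUpperSet U) {b : ι → ℝ} {t d : ℝ} (ht : (b, t) ∈ U) (hd : (b, d) ∉ closure U) :
    ∃ y : ι → ℝ, 0 ≤ y ∧ ∃ d' > d, ∀ z ∈ U, d' + b ⬝ᵥ y ≤ z.2 + z.1 ⬝ᵥ y := by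
  classical
  obtain ⟨F, c, hFd, hFU⟩ := geometric_hahn_banach_point_closed hconv.closure isClosed_closure hd
  replace hFU : ∀ z ∈ U, c < F z := fun z hz => hFU z (subset_closure hz)
  have hnonneg : ∀ v, 0 ≤ v → 0 ≤ F v := fun v hv =>
    map_nonneg_of_forall_mem_upperSet_lt (F := F.toLinearMap) hU ⟨_, ht⟩ hFU hv
  have hτ : 0 < F (0, 1) := by
    refine (hnonneg _ (Prod.mk_le_mk.2 ⟨le_rfl, zero_le_one⟩)).lt_of_ne' fun h => ?_
    have hsub : F ((b, t) - (b, d)) = (t - d) * F (0, 1) := by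
      rw [← smul_eq_mul, ← map_smul]
      simp
    rw [map_sub, h, mul_zero] at hsub
    linarith [hFU _ ht]
  set y : ι → ℝ := fun j => F (Pi.single j 1, 0) / F (0, 1)
  have hF : ∀ z, F z = F (0, 1) * (z.2 + z.1 ⬝ᵥ y) :=
    exists_map_eq_mul_add_dotProduct F.toLinearMap hτ.ne'
  refine ⟨y, fun j => div_nonneg (hnonneg _ ?_) hτ.le, c / F (0, 1) - b ⬝ᵥ y, ?_, fun z hz => ?_⟩
  · exact Prod.mk_le_mk.2 ⟨Pi.single_nonneg.2 zero_le_one, le_rfl⟩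
  · rw [hF] at hFd
    exact lt_sub_iff_add_lt.2 ((lt_div_iff₀' hτ).2 hFd)
  · rw [sub_add_cancel, div_le_iff₀' hτ, ← hF]
    exact (hFU z hz).le

end LagrangeMultiplier

section Conjugate

lemma exists_mem_dom_forall_le {E : Type*} [TopologicalSpace E] {f : E → EReal}
    (hne : (dom f).Nonempty) (hlsc : LowerSemicontinuous f) (hK : IsCompact (closure (dom f))) :
    ∃ a ∈ dom f, ∀ x, f a ≤ f x := by
  obtain ⟨a, -, ha⟩ := (hlsc.lowerSemicontinuousOn _).exists_isMinOn hne.closure hK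
  obtain ⟨x₀, hx₀⟩ := hne
  refine ⟨a, (show f a ≤ f x₀ from ha (subset_closure hx₀)).trans_lt hx₀, fun x => ?_⟩
  by_cases hx : f x < ⊤
  · exact ha (subset_closure hx)
  · exact (not_lt_top_iff.1 hx).symm ▸ le_top

lemma exists_mem_dom_conjugate_eq {N : ℕ} {f : (Fin N → ℝ) → EReal} (hf : IsProper f)
    (hlsc : LowerSemicontinuous f) (hbdd : Bornology.IsBounded (dom f)) (u : Fin N → ℝ) :
    ∃ x ∈ dom f, conjugate f u = ((u ⬝ᵥ x : ℝ) : EReal) - f x := by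
  let g : (Fin N → ℝ) → EReal := fun x => f x - ((u ⬝ᵥ x : ℝ) : EReal)
  have hneg : ∀ x, -g x = ((u ⬝ᵥ x : ℝ) : EReal) - f x := fun x => by
    rw [EReal.neg_sub (.inr (EReal.coe_ne_bot _)) (.inr (EReal.coe_ne_top _)), add_comm,
      sub_eq_add_neg]
  have hdom : dom g = dom f := by
    ext x
    simp only [dom, Set.mem_ofPred_eq, g, lt_top_iff_ne_top]
    exact EReal.add_ne_top_iff_ne_top_left (EReal.coe_ne_bot (-(u ⬝ᵥ x))) (EReal.coe_ne_top _)
  have hg : LowerSemicontinuous g := by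
    have hcont : Continuous fun x => ((-(u ⬝ᵥ x) : ℝ) : EReal) :=
      continuous_coe_real_ereal.comp (by fun_prop)
    exact hlsc.add' hcont.lowerSemicontinuous fun x =>
      EReal.continuousAt_add (.inr (EReal.coe_ne_bot _)) (.inr (EReal.coe_ne_top _))
  obtain ⟨a, ha, hmin⟩ := exists_mem_dom_forall_le (hdom ▸ hf.2) hg (hdom ▸ hbdd.isCompact_closure)
  refine ⟨a, hdom ▸ ha, le_antisymm (iSup_le fun x => ?_) (le_iSup_of_le a le_rfl)⟩
  rw [← hneg, ← hneg]
  exact EReal.neg_le_neg_iff.2 (hmin x)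

lemma neg_transpose_mulVec_dotProduct {R m n : Type*} [CommRing R] [Fintype m] [Fintype n]
    (A : Matrix m n R) (y : m → R) (x : n → R) : -(Aᵀ *ᵥ y) ⬝ᵥ x = -((A *ᵥ x) ⬝ᵥ y) := by
  rw [neg_dotProduct, Matrix.mulVec_transpose, ← Matrix.dotProduct_mulVec, dotProduct_comm]

lemma exists_mem_epigraphImage_conjugate_eq {m N : ℕ} {f : (Fin N → ℝ) → EReal} (hf : IsProper f)
    (hlsc : LowerSemicontinuous f) (hbdd : Bornology.IsBounded (dom f))
    (A : Matrix (Fin m) (Fin N) ℝ) (y : Fin m → ℝ) :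
    ∃ z ∈ epigraphImage A.mulVecLin f,
      conjugate f (-(Aᵀ *ᵥ y)) = ((-(z.2 + z.1 ⬝ᵥ y) : ℝ) : EReal) := by
  obtain ⟨x, hx, hconj⟩ := exists_mem_dom_conjugate_eq hf hlsc hbdd (-(Aᵀ *ᵥ y))
  lift f x to ℝ using ⟨hx.ne, hf.1 x⟩ with r hr
  refine ⟨(A *ᵥ x, r), ⟨x, rfl, hr.ge⟩, ?_⟩
  rw [hconj, neg_transpose_mulVec_dotProduct, ← EReal.coe_sub, neg_add']
  congr 1
  ring

end Conjugate

section Duality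

open scoped Pointwise

variable {m n : ℕ} {N : Fin n → ℕ} {f : (i : Fin n) → (Fin (N i) → ℝ) → EReal}
  {A : (i : Fin n) → Matrix (Fin m) (Fin (N i)) ℝ} {b : Fin m → ℝ}

lemma exists_lagrangian_le_dualValue (hproper : ∀ i, IsProper (f i))
    (hlsc : ∀ i, LowerSemicontinuous (f i)) (hbdd : ∀ i, Bornology.IsBounded (dom (f i)))
    {y : Fin m → ℝ} (hy : 0 ≤ y) :
    ∃ z ∈ ∑ i, epigraphImage (A i).mulVecLin (f i),
      ((z.2 + z.1 ⬝ᵥ y - b ⬝ᵥ y : ℝ) : EReal) ≤ dualValue f A b := by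
  choose p hp hconj using fun i =>
    exists_mem_epigraphImage_conjugate_eq (hproper i) (hlsc i) (hbdd i) (A i) y
  refine ⟨∑ i, p i, Set.finsetSum_mem_finsetSum _ _ _ fun i _ => hp i,
    le_iSup₂_of_le y hy (le_of_eq ?_)⟩
  simp only [hconj, ← coe_sum, ← EReal.coe_neg, ← EReal.coe_sub]
  simp only [Prod.fst_sum, Prod.snd_sum, sum_dotProduct, Finset.sum_neg_distrib,
    Finset.sum_add_distrib, neg_neg]

lemma dualValue_le_primalValue (hbot : ∀ i x, f i x ≠ ⊥) :
    dualValue f A b ≤ primalValue f A b := by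
  refine iSup₂_le fun y hy => le_iInf₂ fun x hx => ?_
  rcases eq_or_ne (∑ i, f i (x i)) ⊤ with htop | htop
  · exact htop.symm ▸ le_top
  obtain ⟨r, hr⟩ := exists_forall_eq_coe_of_sum_ne_top (fun i => hbot i (x i)) htop
  have fenchel_young : ∀ i, ((-((A i *ᵥ x i) ⬝ᵥ y) - r i : ℝ) : EReal) ≤
      conjugate (f i) (-((A i)ᵀ *ᵥ y)) := fun i =>
    le_iSup_of_le (x i) (by rw [neg_transpose_mulVec_dotProduct, hr, EReal.coe_sub])
  have hxy : (∑ i, A i *ᵥ x i) ⬝ᵥ y ≤ b ⬝ᵥ y := dotProduct_le_dotProduct_of_nonneg_right hx hy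
  calc -(∑ i, conjugate (f i) (-((A i)ᵀ *ᵥ y))) - ((b ⬝ᵥ y : ℝ) : EReal)
      ≤ -(∑ i, ((-((A i *ᵥ x i) ⬝ᵥ y) - r i : ℝ) : EReal)) - ((b ⬝ᵥ y : ℝ) : EReal) :=
        EReal.sub_le_sub (EReal.neg_le_neg_iff.2 (Finset.sum_le_sum fun i _ => fenchel_young i))
          le_rfl
    _ = ((∑ i, r i + (∑ i, A i *ᵥ x i) ⬝ᵥ y - b ⬝ᵥ y : ℝ) : EReal) := by
        rw [← coe_sum, ← EReal.coe_neg, ← EReal.coe_sub, Finset.sum_sub_distrib,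
          Finset.sum_neg_distrib, sum_dotProduct, neg_sub, sub_neg_eq_add]
    _ ≤ ((∑ i, r i : ℝ) : EReal) := EReal.coe_le_coe (by linarith)
    _ = ∑ i, f i (x i) := by simp only [coe_sum, hr]

lemma exists_mem_upperClosure_of_primalValue_lt_top (hbot : ∀ i x, f i x ≠ ⊥)
    (hfeas : primalValue f A b < ⊤) :
    ∃ t : ℝ, (b, t) ∈ upperClosure (∑ i, epigraphImage (A i).mulVecLin (f i)) := by
  simp only [primalValue, iInf_lt_iff] at hfeas
  obtain ⟨x, hx, htop⟩ := hfeas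
  obtain ⟨t, ht, -⟩ := EReal.lt_iff_exists_real_btwn.1 htop
  exact ⟨t, (mem_upperClosure_sum_epigraphImage hbot).2 ⟨x, hx, ht.le⟩⟩

lemma primalValue_le_of_mem_upperClosure (hbot : ∀ i x, f i x ≠ ⊥) {t : ℝ}
    (ht : (b, t) ∈ upperClosure (∑ i, epigraphImage (A i).mulVecLin (f i))) :
    primalValue f A b ≤ t := by
  obtain ⟨x, hx, hxt⟩ := (mem_upperClosure_sum_epigraphImage hbot).1 ht
  exact iInf₂_le_of_le x hx hxt

lemma mem_closure_upperClosure_convexHull_of_dualValue_eq (hproper : ∀ i, IsProper (f i))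
    (hlsc : ∀ i, LowerSemicontinuous (f i)) (hbdd : ∀ i, Bornology.IsBounded (dom (f i)))
    (hfeas : primalValue f A b < ⊤) {d : ℝ} (hd : dualValue f A b = d) :
    (b, d) ∈ closure (upperClosure
      (convexHull ℝ (∑ i, epigraphImage (A i).mulVecLin (f i))) : Set ((Fin m → ℝ) × ℝ)) := by
  by_contra hbd
  obtain ⟨t, v, hv, hvt⟩ :=
    exists_mem_upperClosure_of_primalValue_lt_top (fun i => (hproper i).1) hfeas
  obtain ⟨y, hy, d', hd', hle⟩ := exists_lagrange_multiplier
    (convex_upperClosure (convex_convexHull ℝ _)) (upperClosure _).upper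
    ⟨v, subset_convexHull ℝ _ hv, hvt⟩ hbd
  obtain ⟨z, hz, hzd⟩ := exists_lagrangian_le_dualValue (A := A) (b := b) hproper hlsc hbdd hy
  rw [hd, EReal.coe_le_coe_iff] at hzd
  linarith [hle z (subset_upperClosure (subset_convexHull ℝ _ hz))]

lemma primalValue_le_add_sum_nonconvexity (hproper : ∀ i, IsProper (f i))
    (hlsc : ∀ i, LowerSemicontinuous (f i)) (hbdd : ∀ i, Bornology.IsBounded (dom (f i)))
    {k : Fin n → ℕ} (hk : ∀ i, 1 ≤ k i) {d : ℝ}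
    (hd : (b, d) ∈ closure (upperClosure
      (∑ i, convexCombinations ℝ (k i) (epigraphImage (A i).mulVecLin (f i))) :
        Set ((Fin m → ℝ) × ℝ))) :
    primalValue f A b ≤ d + ∑ i, nonconvexity (k i) (f i) := by
  have hbot : ∀ i x, f i x ≠ ⊥ := fun i => (hproper i).1
  rcases eq_or_ne (∑ i, nonconvexity (k i) (f i)) ⊤ with htop | htop
  · rw [htop, EReal.coe_add_top]
    exact le_top
  obtain ⟨ρ, hρ⟩ := exists_forall_eq_coe_of_sum_ne_top
    (fun i => (EReal.bot_lt_zero.trans_le (nonconvexity_nonneg (hproper i) (hk i))).ne') htop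
  have hmaps : Set.MapsTo (· + ((0, ∑ i, ρ i) : (Fin m → ℝ) × ℝ))
      (upperClosure (∑ i, convexCombinations ℝ (k i) (epigraphImage (A i).mulVecLin (f i))))
      (upperClosure (∑ i, epigraphImage (A i).mulVecLin (f i))) := by
    rintro z ⟨v, hv, hvz⟩
    obtain ⟨p, hp, rfl⟩ := (Set.mem_fintype_sum _ _).1 hv
    refine ⟨∑ i, (p i + (0, ρ i)), Set.finsetSum_mem_finsetSum _ _ _ fun i _ =>
      add_mem_epigraphImage_of_mem_convexCombinations (hbot i) (hρ i).le (hp i), ?_⟩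
    have hsum : ∑ i, ((0, ρ i) : (Fin m → ℝ) × ℝ) = (0, ∑ i, ρ i) := by
      ext <;> simp [Prod.fst_sum, Prod.snd_sum]
    rw [Finset.sum_add_distrib, hsum]
    exact add_le_add_left hvz _
  have hclosed := isClosed_upperClosure_sum_epigraphImage hbot
    (fun i => (A i).mulVecLin.continuous_of_finiteDimensional) hlsc
    fun i => (hbdd i).isCompact_closure
  have hmem : (b, d) + (0, ∑ i, ρ i) ∈ upperClosure (∑ i, epigraphImage (A i).mulVecLin (f i)) :=
    hclosed.closure_subset (hmaps.closure (by fun_prop) hd)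
  rw [Prod.mk_add_mk, add_zero] at hmem
  simpa only [hρ, ← coe_sum, ← EReal.coe_add] using primalValue_le_of_mem_upperClosure hbot hmem

end Duality

end SeparableDuality

theorem theorem3 {m n : ℕ} (N : Fin n → ℕ)
    (f : (i : Fin n) → (Fin (N i) → ℝ) → EReal)
    (A : (i : Fin n) → Matrix (Fin m) (Fin (N i)) ℝ) (b : Fin m → ℝ)
    (hproper : ∀ i, SeparableDuality.IsProper (f i))
    (hlsc : ∀ i, LowerSemicontinuous (f i))
    (hbdd : ∀ i, Bornology.IsBounded (SeparableDuality.dom (f i)))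
    (hfeas : SeparableDuality.primalValue f A b < ⊤) :
    (⊥ < SeparableDuality.primalValue f A b ∧
      ⊥ < SeparableDuality.dualValue f A b ∧ SeparableDuality.dualValue f A b < ⊤) ∧
    ∃ k : Fin n → ℕ, (∀ i, 1 ≤ k i ∧ k i ≤ m + 1) ∧ ∑ i, k i ≤ m + n ∧
      SeparableDuality.primalValue f A b - SeparableDuality.dualValue f A b
        ≤ ∑ i, SeparableDuality.nonconvexity (k i) (f i) := by
  have hweak := SeparableDuality.dualValue_le_primalValue (A := A) (b := b) fun i => (hproper i).1
  obtain ⟨z, -, hz⟩ :=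
    SeparableDuality.exists_lagrangian_le_dualValue (A := A) (b := b) hproper hlsc hbdd le_rfl
  have hbot : ⊥ < SeparableDuality.dualValue f A b := (EReal.bot_lt_coe _).trans_le hz
  have htop : SeparableDuality.dualValue f A b < ⊤ := hweak.trans_lt hfeas
  refine ⟨⟨hbot.trans_le hweak, hbot, htop⟩, ?_⟩
  lift SeparableDuality.dualValue f A b to ℝ using ⟨htop.ne, hbot.ne'⟩ with d hd
  obtain ⟨k, hk, hsum, hmem⟩ :=
    SeparableDuality.exists_mem_closure_upperClosure_sum_convexCombinations
      (SeparableDuality.mem_closure_upperClosure_convexHull_of_dualValue_eq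
        hproper hlsc hbdd hfeas hd.symm)
  rw [Module.finrank_fin_fun] at hsum
  refine ⟨k, fun i => ⟨hk i, SeparableDuality.le_add_one_of_sum_le_add_card hk hsum i⟩,
    by simpa only [Fintype.card_fin] using hsum, EReal.sub_le_of_le_add' ?_⟩
  exact SeparableDuality.primalValue_le_add_sum_nonconvexity hproper hlsc hbdd hk hmem
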